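/- For a metric space $X$ and $\delta\ge 0$, the Vietoris--Rips metric thickening $X_\delta$ is the set of probability measures on $X$ with finite support of diameter at most $\delta$, equipped with the $1$-Wasserstein metric. Let $S^d\subset\mathbb{R}^{d+1}$ be the unit sphere with its geodesic metric (so that antipodal points are at distance $\pi$). The thickening $S^d_\delta$ carries the involution $-\sum_i\lambda_i x_i=\sum_i\lambda_i(-x_i)$, where $\sum_i\lambda_i x_i$ denotes the measure with mass $\lambda_i$ at $x_i$; a map $f\colon S^n\to S^d_\delta$ is odd if $f(-x)=-f(x)$ for all $x$. The coindex $\mathrm{coind}(Y)$ of a space $Y$ with a continuous involution is the largest $n$ such that there is a continuous odd map $S^n\to Y$ ($\infty$ if such maps exist for arbitrarily large $n$). **Corollary.** Let $k\ge 1$ be an integer. 1. For every $\delta>\frac{\pi}{2}$ there is $d_0=d_0(k,\delta)$ such that for all $d\ge d_0$ there is a continuous odd map $S^{d+k}\to S^d_\delta$; in particular, $\mathrm{coind}(S^d_\delta)\ge d+k$. 2. There is a function $\varepsilon\colon\mathbb{N}\to\mathbb{R}$, depending only on $k$, with $\varepsilon(d)\to 0$ as $d\to\infty$, such that for every integer $d\ge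 1$ and every $\delta>\frac{\pi}{2}$ with $$\delta>\pi-\arccos\left((1+\varepsilon(d))\,\frac{2\sqrt{k+2}}{d+1}\right)$$ there is a continuous odd map $S^{d+k}\to S^d_\delta$. Here $\arccos$ is extended to $\mathbb{R}$ by $\arccos(t)=0$ for $t>1$ and $\arccos(t)=\pi$ for $t<-1$. -/

import Mathlib

/-! ### The 1-Wasserstein distance between finitely supported probability measures

`Convexity.StdSimplex ℝ X` is Mathlib's type of finitely supported probability distributions
`μ = ∑ λᵢ xᵢ` on `X`; `μ.weights : X →₀ ℝ` is the function `x ↦ μ({x})`, and `μ.map g` is the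
push-forward of `μ` along `g`. -/

namespace VR

open Convexity

noncomputable section

/-- The integral `∫ F dμ = ∑ₓ μ({x}) F(x)`. -/
def integral {Y : Type*} (μ : StdSimplex ℝ Y) (F : Y → ℝ) : ℝ :=
  μ.weights.sum fun y r => r * F y

/-- `γ` is a coupling (transport plan) of `μ` and `ν`: its two marginals are `μ` and `ν`. -/
def IsCoupling {X : Type*} (γ : StdSimplex ℝ (X × X)) (μ ν : StdSimplex ℝ X) : Prop :=
  γ.map Prod.fst = μ ∧ γ.map Prod.snd = ν

/-- The 1-Wasserstein distance: the infimum over all couplings of the transport cost. -/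
def wasserstein {X : Type*} [MetricSpace X] (μ ν : StdSimplex ℝ X) : ℝ :=
  sInf {c : ℝ | ∃ γ : StdSimplex ℝ (X × X),
    IsCoupling γ μ ν ∧ c = integral γ fun p => dist p.1 p.2}

section Wasserstein

theorem integral_eq {Y : Type*} (μ : StdSimplex ℝ Y) (F : Y → ℝ) :
    integral μ F = Finsupp.linearCombination ℝ F μ.weights := by
  simp [integral, Finsupp.linearCombination_apply]

theorem integral_eq_sum {Y : Type*} (μ : StdSimplex ℝ Y) (F : Y → ℝ) :
    integral μ F = ∑ y ∈ μ.weights.support, μ.weights y * F y := rfl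

theorem integral_map {Y Z : Type*} (μ : StdSimplex ℝ Y) (g : Y → Z) (F : Z → ℝ) :
    integral (μ.map g) F = integral μ (F ∘ g) := by
  simp [integral_eq, Finsupp.linearCombination_mapDomain]

theorem integral_add {Y : Type*} (μ : StdSimplex ℝ Y) (F G : Y → ℝ) :
    integral μ (fun y => F y + G y) = integral μ F + integral μ G := by
  simp [integral_eq_sum, mul_add, Finset.sum_add_distrib]

theorem integral_sub {Y : Type*} (μ : StdSimplex ℝ Y) (F G : Y → ℝ) :
    integral μ (fun y => F y - G y) = integral μ F - integral μ G := by
  simp [integral_eq_sum, mul_sub, Finset.sum_sub_distrib]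

theorem integral_mono {Y : Type*} (μ : StdSimplex ℝ Y) {F G : Y → ℝ} (h : ∀ y, F y ≤ G y) :
    integral μ F ≤ integral μ G :=
  Finset.sum_le_sum fun y _ => mul_le_mul_of_nonneg_left (h y) (μ.weights_nonneg y)

theorem integral_nonneg {Y : Type*} (μ : StdSimplex ℝ Y) {F : Y → ℝ} (h : ∀ y, 0 ≤ F y) :
    0 ≤ integral μ F :=
  Finset.sum_nonneg fun y _ => mul_nonneg (μ.weights_nonneg y) (h y)

theorem integral_indicator {Y : Type*} [DecidableEq Y] (μ : StdSimplex ℝ Y) (a : Y) :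
    integral μ (fun y => if y = a then 1 else 0) = μ.weights a := by
  rw [integral_eq_sum]
  simp only [mul_ite, mul_one, mul_zero, Finset.sum_ite_eq']
  split_ifs with h
  · rfl
  · exact (Finsupp.notMem_support_iff.mp h).symm

theorem ext_integral {Y : Type*} {μ ν : StdSimplex ℝ Y}
    (h : ∀ F : Y → ℝ, integral μ F = integral ν F) : μ = ν := by
  classical
  apply StdSimplex.ext
  ext a
  rw [← integral_indicator μ a, ← integral_indicator ν a, h]

variable {X : Type*}

theorem IsCoupling.fst_integral {γ : StdSimplex ℝ (X × X)} {μ ν : StdSimplex ℝ X}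
    (h : IsCoupling γ μ ν) (F : X → ℝ) : integral γ (fun p => F p.1) = integral μ F := by
  rw [← h.1, integral_map]; rfl

theorem IsCoupling.snd_integral {γ : StdSimplex ℝ (X × X)} {μ ν : StdSimplex ℝ X}
    (h : IsCoupling γ μ ν) (F : X → ℝ) : integral γ (fun p => F p.2) = integral ν F := by
  rw [← h.2, integral_map]; rfl

theorem isCoupling_diag (μ : StdSimplex ℝ X) : IsCoupling (μ.map fun x => (x, x)) μ μ := by
  constructor <;> rw [StdSimplex.map_map] <;> exact μ.map_id

theorem IsCoupling.swap {γ : StdSimplex ℝ (X × X)} {μ ν : StdSimplex ℝ X}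
    (h : IsCoupling γ μ ν) : IsCoupling (γ.map Prod.swap) ν μ := by
  constructor <;> rw [StdSimplex.map_map]
  · exact h.2
  · exact h.1

theorem IsCoupling.map {Y : Type*} {γ : StdSimplex ℝ (X × X)} {μ ν : StdSimplex ℝ X}
    (h : IsCoupling γ μ ν) (g : X → Y) :
    IsCoupling (γ.map (Prod.map g g)) (μ.map g) (ν.map g) := by
  constructor <;> rw [StdSimplex.map_map]
  · rw [← h.1, StdSimplex.map_map]; rfl
  · rw [← h.2, StdSimplex.map_map]; rfl

/-- The independent coupling shows that couplings exist. -/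
theorem exists_isCoupling (μ ν : StdSimplex ℝ X) : ∃ γ, IsCoupling γ μ ν := by
  classical
  let w : X × X →₀ ℝ := ∑ x ∈ μ.weights.support, ∑ y ∈ ν.weights.support,
    Finsupp.single (x, y) (μ.weights x * ν.weights y)
  have hw : ∀ F : X × X → ℝ, Finsupp.linearCombination ℝ F w =
      ∑ x ∈ μ.weights.support, ∑ y ∈ ν.weights.support,
        (μ.weights x * ν.weights y) * F (x, y) := by
    intro F; simp only [w, map_sum, Finsupp.linearCombination_single, smul_eq_mul]
  have hμ : ∑ x ∈ μ.weights.support, μ.weights x = 1 := μ.total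
  have hν : ∑ x ∈ ν.weights.support, ν.weights x = 1 := ν.total
  let γ : StdSimplex ℝ (X × X) :=
    { weights := w
      nonneg := Finset.sum_nonneg fun x _ => Finset.sum_nonneg fun y _ =>
        Finsupp.single_nonneg.mpr (mul_nonneg (μ.weights_nonneg x) (ν.weights_nonneg y))
      total := by
        have := hw fun _ => 1
        rw [Finsupp.linearCombination_apply] at this
        simp only [smul_eq_mul, mul_one, ← Finset.mul_sum, hν, hμ] at this
        exact this }
  have hγ : ∀ F, integral γ F = ∑ x ∈ μ.weights.support, ∑ y ∈ ν.weights.support,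
        (μ.weights x * ν.weights y) * F (x, y) := fun F => by rw [integral_eq]; exact hw F
  refine ⟨γ, ext_integral fun F => ?_, ext_integral fun F => ?_⟩
  · rw [integral_map, hγ, integral_eq_sum]
    refine Finset.sum_congr rfl fun x _ => ?_
    simp only [Function.comp, ← Finset.sum_mul, ← Finset.mul_sum, hν, mul_one]
  · rw [integral_map, hγ, integral_eq_sum, Finset.sum_comm]
    refine Finset.sum_congr rfl fun x _ => ?_
    simp only [Function.comp, ← Finset.sum_mul, hμ, one_mul]

/-- The gluing lemma. -/
theorem exists_glue [MetricSpace X] {γ₁ γ₂ : StdSimplex ℝ (X × X)} {μ ν ρ : StdSimplex ℝ X}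
    (h₁ : IsCoupling γ₁ μ ν) (h₂ : IsCoupling γ₂ ν ρ) :
    ∃ γ, IsCoupling γ μ ρ ∧ integral γ (fun p => dist p.1 p.2) ≤
      integral γ₁ (fun p => dist p.1 p.2) + integral γ₂ (fun p => dist p.1 p.2) := by
  classical
  let S := γ₁.weights.support
  let T := γ₂.weights.support
  let c : X × X → X × X → ℝ := fun p q =>
    if p.2 = q.1 then γ₁.weights p * γ₂.weights q / ν.weights p.2 else 0
  have hc : ∀ p q, 0 ≤ c p q := by
    intro p q
    simp only [c]
    split_ifs
    · exact div_nonneg (mul_nonneg (γ₁.weights_nonneg _) (γ₂.weights_nonneg _))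
        (ν.weights_nonneg _)
    · exact le_rfl
  have hν₁ : ∀ a, ν.weights a = ∑ p ∈ S, if p.2 = a then γ₁.weights p else 0 := by
    intro a
    rw [← integral_indicator, ← h₁.snd_integral, integral_eq_sum]
    simp [S]
  have hν₂ : ∀ a, ν.weights a = ∑ q ∈ T, if q.1 = a then γ₂.weights q else 0 := by
    intro a
    rw [← integral_indicator, ← h₂.fst_integral, integral_eq_sum]
    simp [T]
  have hpos : ∀ p ∈ S, ν.weights p.2 ≠ 0 := by
    intro p hp h0
    rw [hν₁, Finset.sum_eq_zero_iff_of_nonneg] at h0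
    · have := h0 p hp
      simp only [if_true] at this
      exact Finsupp.mem_support_iff.mp hp this
    · intro q _
      split_ifs
      · exact γ₁.weights_nonneg _
      · exact le_rfl
  have hpos' : ∀ q ∈ T, ν.weights q.1 ≠ 0 := by
    intro p hp h0
    rw [hν₂, Finset.sum_eq_zero_iff_of_nonneg] at h0
    · have := h0 p hp
      simp only [if_true] at this
      exact Finsupp.mem_support_iff.mp hp this
    · intro q _
      split_ifs
      · exact γ₂.weights_nonneg _
      · exact le_rfl
  have hT : ∀ p ∈ S, ∑ q ∈ T, c p q = γ₁.weights p := by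
    intro p hp
    have : ∀ q ∈ T, c p q = (γ₁.weights p / ν.weights p.2) *
        (if q.1 = p.2 then γ₂.weights q else 0) := by
      intro q _
      by_cases h : p.2 = q.1
      · simp only [c, if_pos h, if_pos h.symm]; ring
      · simp [c, if_neg h, if_neg (Ne.symm h)]
    rw [Finset.sum_congr rfl this, ← Finset.mul_sum, ← hν₂, div_mul_cancel₀ _ (hpos p hp)]
  have hS : ∀ q ∈ T, ∑ p ∈ S, c p q = γ₂.weights q := by
    intro q hq
    have : ∀ p ∈ S, c p q = (γ₂.weights q / ν.weights q.1) *
        (if p.2 = q.1 then γ₁.weights p else 0) := by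
      intro p _
      by_cases h : p.2 = q.1
      · simp only [c, h, if_true]; ring
      · simp [c, if_neg h]
    rw [Finset.sum_congr rfl this, ← Finset.mul_sum, ← hν₁, div_mul_cancel₀ _ (hpos' q hq)]
  let w : X × X →₀ ℝ := ∑ p ∈ S, ∑ q ∈ T, Finsupp.single (p.1, q.2) (c p q)
  have hw : ∀ F : X × X → ℝ, Finsupp.linearCombination ℝ F w =
      ∑ p ∈ S, ∑ q ∈ T, c p q * F (p.1, q.2) := by
    intro F; simp only [w, map_sum, Finsupp.linearCombination_single, smul_eq_mul]
  let γ : StdSimplex ℝ (X × X) :=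
    { weights := w
      nonneg := Finset.sum_nonneg fun x _ => Finset.sum_nonneg fun y _ =>
        Finsupp.single_nonneg.mpr (hc x y)
      total := by
        have := hw fun _ => 1
        rw [Finsupp.linearCombination_apply] at this
        simp only [smul_eq_mul, mul_one] at this
        rw [Finset.sum_congr rfl hT] at this
        exact this.trans γ₁.total }
  have hγ : ∀ F, integral γ F = ∑ p ∈ S, ∑ q ∈ T, c p q * F (p.1, q.2) :=
    fun F => by rw [integral_eq]; exact hw F
  refine ⟨γ, ⟨ext_integral fun F => ?_, ext_integral fun F => ?_⟩, ?_⟩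
  · rw [integral_map, hγ, ← h₁.fst_integral, integral_eq_sum]
    refine Finset.sum_congr rfl fun p hp => ?_
    simp only [Function.comp, ← Finset.sum_mul, hT p hp]
  · rw [integral_map, hγ, ← h₂.snd_integral, integral_eq_sum, Finset.sum_comm]
    refine Finset.sum_congr rfl fun q hq => ?_
    simp only [Function.comp, ← Finset.sum_mul, hS q hq]
  · rw [hγ]
    have e₁ : integral γ₁ (fun p => dist p.1 p.2) = ∑ p ∈ S, ∑ q ∈ T, c p q * dist p.1 p.2 := by
      rw [integral_eq_sum]
      refine Finset.sum_congr rfl fun p hp => ?_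
      rw [← Finset.sum_mul, hT p hp]
    have e₂ : integral γ₂ (fun p => dist p.1 p.2) = ∑ p ∈ S, ∑ q ∈ T, c p q * dist q.1 q.2 := by
      rw [integral_eq_sum, Finset.sum_comm]
      refine Finset.sum_congr rfl fun q hq => ?_
      rw [← Finset.sum_mul, hS q hq]
    rw [e₁, e₂, ← Finset.sum_add_distrib]
    refine Finset.sum_le_sum fun p _ => ?_
    rw [← Finset.sum_add_distrib]
    refine Finset.sum_le_sum fun q _ => ?_
    by_cases h : p.2 = q.1
    · rw [← mul_add]
      refine mul_le_mul_of_nonneg_left ?_ (hc p q)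
      simpa [h] using dist_triangle p.1 p.2 q.2
    · simp [c, h]

variable [MetricSpace X]

theorem wasserstein_le {γ : StdSimplex ℝ (X × X)} {μ ν : StdSimplex ℝ X}
    (h : IsCoupling γ μ ν) : wasserstein μ ν ≤ integral γ fun p => dist p.1 p.2 := by
  refine csInf_le ⟨0, ?_⟩ ⟨γ, h, rfl⟩
  rintro _ ⟨γ', -, rfl⟩
  exact integral_nonneg γ' fun p => dist_nonneg

theorem le_wasserstein {μ ν : StdSimplex ℝ X} {b : ℝ}
    (h : ∀ γ, IsCoupling γ μ ν → b ≤ integral γ fun p => dist p.1 p.2) :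
    b ≤ wasserstein μ ν := by
  obtain ⟨γ, hγ⟩ := exists_isCoupling μ ν
  refine le_csInf ⟨_, γ, hγ, rfl⟩ ?_
  rintro _ ⟨γ', h', rfl⟩
  exact h γ' h'

theorem exists_lt_of_wasserstein_lt {μ ν : StdSimplex ℝ X} {b : ℝ} (h : wasserstein μ ν < b) :
    ∃ γ, IsCoupling γ μ ν ∧ integral γ (fun p => dist p.1 p.2) < b := by
  by_contra! H
  exact absurd h (not_lt.mpr (le_wasserstein H))

theorem wasserstein_nonneg (μ ν : StdSimplex ℝ X) : 0 ≤ wasserstein μ ν :=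
  le_wasserstein fun γ _ => integral_nonneg γ fun _ => dist_nonneg

theorem wasserstein_self (μ : StdSimplex ℝ X) : wasserstein μ μ = 0 := by
  refine le_antisymm ?_ (wasserstein_nonneg μ μ)
  refine (wasserstein_le (isCoupling_diag μ)).trans ?_
  rw [integral_map]
  simp [integral]

theorem wasserstein_comm_le (μ ν : StdSimplex ℝ X) : wasserstein μ ν ≤ wasserstein ν μ := by
  refine le_wasserstein fun γ hγ => (wasserstein_le hγ.swap).trans_eq ?_
  rw [integral_map]
  simp [Function.comp_def, dist_comm]

theorem wasserstein_triangle (μ ν ρ : StdSimplex ℝ X) :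
    wasserstein μ ρ ≤ wasserstein μ ν + wasserstein ν ρ := by
  refine le_of_forall_pos_le_add fun e he => ?_
  obtain ⟨γ₁, h₁, l₁⟩ := exists_lt_of_wasserstein_lt
    (lt_add_of_pos_right (wasserstein μ ν) (half_pos he))
  obtain ⟨γ₂, h₂, l₂⟩ := exists_lt_of_wasserstein_lt
    (lt_add_of_pos_right (wasserstein ν ρ) (half_pos he))
  obtain ⟨γ, h, l⟩ := exists_glue h₁ h₂
  linarith [wasserstein_le h]

theorem integral_sub_le_wasserstein {F : X → ℝ} (hF : ∀ x y, F x - F y ≤ dist x y)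
    (μ ν : StdSimplex ℝ X) : integral μ F - integral ν F ≤ wasserstein μ ν := by
  refine le_wasserstein fun γ hγ => ?_
  rw [← hγ.fst_integral, ← hγ.snd_integral, ← integral_sub]
  exact integral_mono γ fun p => hF p.1 p.2

theorem eq_of_wasserstein_eq_zero {μ ν : StdSimplex ℝ X} (h : wasserstein μ ν = 0) : μ = ν := by
  classical
  have h' : wasserstein ν μ = 0 :=
    le_antisymm ((wasserstein_comm_le ν μ).trans h.le) (wasserstein_nonneg _ _)
  apply StdSimplex.ext
  ext a
  let T : Set X := ↑((μ.weights.support ∪ ν.weights.support).erase a)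
  have hfin : T.Finite := Finset.finite_toSet _
  have haT : a ∈ Tᶜ := by simp [T]
  obtain ⟨e, he, hball⟩ := Metric.isOpen_iff.mp hfin.isClosed.isOpen_compl a haT
  let F : X → ℝ := fun x => max (e - dist x a) 0
  have hF : ∀ x y, F x - F y ≤ dist x y := by
    intro x y
    have h1 := dist_triangle y x a
    have h2 : e - dist y a ≤ F y := le_max_left _ _
    have h3 : 0 ≤ F y := le_max_right _ _
    have h4 : (0 : ℝ) ≤ dist x y := dist_nonneg
    rw [dist_comm y x] at h1
    have : F x ≤ F y + dist x y := max_le (by linarith) (by linarith)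
    linarith
  have key : ∀ σ : StdSimplex ℝ X, σ.weights.support ⊆ μ.weights.support ∪ ν.weights.support →
      integral σ F = e * σ.weights a := by
    intro σ hσ
    have : ∀ y ∈ σ.weights.support, σ.weights y * F y =
        e * (σ.weights y * if y = a then 1 else 0) := by
      intro y hy
      by_cases hya : y = a
      · subst hya; simp [F, he.le, mul_comm]
      · have hyT : y ∈ T := by
          simp only [T, Finset.coe_erase, Set.mem_sdiff, Finset.mem_coe, Set.mem_singleton_iff]
          exact ⟨hσ hy, hya⟩
        have : ¬ dist y a < e := fun hlt => hball hlt hyT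
        have h0 : F y = 0 := max_eq_right (by linarith)
        simp [hya, h0]
    rw [integral_eq_sum, Finset.sum_congr rfl this, ← Finset.mul_sum, ← integral_indicator σ a,
      integral_eq_sum]
  have k1 := integral_sub_le_wasserstein hF μ ν
  have k2 := integral_sub_le_wasserstein hF ν μ
  rw [key μ Finset.subset_union_left, key ν Finset.subset_union_right] at k1 k2
  rw [h] at k1
  rw [h'] at k2
  exact mul_left_cancel₀ he.ne' (by linarith)

end Wasserstein

/-! ### Vietoris-Rips metric thickenings -/

/-- The Vietoris-Rips metric thickening `X_δ`: the finitely supported probability measures on `X`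
whose support has diameter at most `δ`. -/
def Thickening (X : Type*) [MetricSpace X] (δ : ℝ) : Type _ :=
  {μ : StdSimplex ℝ X // ∀ x ∈ μ.weights.support, ∀ y ∈ μ.weights.support, dist x y ≤ δ}

/-- `X_δ` carries the 1-Wasserstein metric. -/
instance {X : Type*} [MetricSpace X] {δ : ℝ} : MetricSpace (Thickening X δ) where
  dist μ ν := wasserstein μ.1 ν.1
  dist_self μ := wasserstein_self μ.1
  dist_comm μ ν := le_antisymm (wasserstein_comm_le _ _) (wasserstein_comm_le _ _)
  dist_triangle μ ν ρ := wasserstein_triangle μ.1 ν.1 ρ.1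
  eq_of_dist_eq_zero h := Subtype.ext (eq_of_wasserstein_eq_zero h)

/-- An isometry `g` of `X` acts on `X_δ` by `∑ λᵢ xᵢ ↦ ∑ λᵢ g(xᵢ)`. -/
def Thickening.map {X : Type*} [MetricSpace X] {δ : ℝ} (g : X → X) (hg : Isometry g)
    (μ : Thickening X δ) : Thickening X δ :=
  ⟨μ.1.map g, by
    classical
    intro x hx y hy
    obtain ⟨x', hx', rfl⟩ := Finset.mem_image.mp (Finsupp.mapDomain_support hx)
    obtain ⟨y', hy', rfl⟩ := Finset.mem_image.mp (Finsupp.mapDomain_support hy)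
    rw [hg.dist_eq]
    exact μ.2 x' hx' y' hy'⟩

/-! ### Spheres -/

/-- The unit sphere `S^n` of `ℝ^(n+1)` with its usual topology. -/
abbrev Sphere (n : ℕ) : Type := Metric.sphere (0 : EuclideanSpace ℝ (Fin (n + 1))) 1

/-- The unit sphere `S^d`, as a metric space with the geodesic metric (antipodes are at distance
`π`). -/
def GeoSphere (d : ℕ) : Type := Sphere d

instance (d : ℕ) : InvolutiveNeg (GeoSphere d) := inferInstanceAs (InvolutiveNeg (Sphere d))

instance (d : ℕ) : MetricSpace (GeoSphere d) where
  dist x y := InnerProductGeometry.angle x.1 y.1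
  dist_self x := InnerProductGeometry.angle_self (ne_zero_of_mem_unit_sphere x)
  dist_comm x y := InnerProductGeometry.angle_comm x.1 y.1
  dist_triangle x y z := InnerProductGeometry.angle_le_angle_add_angle x.1 y.1 z.1
  eq_of_dist_eq_zero {x y} h := by
    have hx : ‖x.1‖ = 1 := norm_eq_of_mem_sphere x
    have hy : ‖y.1‖ = 1 := norm_eq_of_mem_sphere y
    refine Subtype.ext ((inner_eq_one_iff_of_norm_eq_one (𝕜 := ℝ) hx hy).mp ?_)
    rw [InnerProductGeometry.inner_eq_mul_norm_iff_angle_eq_zero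
      (ne_zero_of_mem_unit_sphere x) (ne_zero_of_mem_unit_sphere y) |>.mpr h, hx, hy, one_mul]

theorem isometry_neg (d : ℕ) : Isometry (fun x : GeoSphere d => -x) :=
  Isometry.of_dist_eq fun x y => InnerProductGeometry.angle_neg_neg x.1 y.1

/-- `S^d_δ`, the Vietoris-Rips metric thickening of the geodesic sphere `S^d` at scale `δ`. -/
abbrev SphereThickening (d : ℕ) (δ : ℝ) : Type := Thickening (GeoSphere d) δ

/-- The involution `∑ λᵢ xᵢ ↦ ∑ λᵢ (-xᵢ)` of `S^d_δ`. -/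
instance (d : ℕ) (δ : ℝ) : InvolutiveNeg (SphereThickening d δ) where
  neg μ := μ.map (fun x => -x) (isometry_neg d)
  neg_neg μ := Subtype.ext <| by
    change (μ.1.map fun x => -x).map (fun x => -x) = μ.1
    rw [StdSimplex.map_map]
    simp only [neg_neg]
    exact μ.1.map_id

theorem isometry_neg_thickening (d : ℕ) (δ : ℝ) :
    Isometry (fun μ : SphereThickening d δ => -μ) := by
  have key : ∀ μ ν : SphereThickening d δ, dist (-μ) (-ν) ≤ dist μ ν := fun μ ν =>
    le_wasserstein fun γ hγ => (wasserstein_le (hγ.map fun x => -x)).trans_eq <| by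
      rw [integral_map]
      congr 1
      funext p
      exact (isometry_neg d).dist_eq p.1 p.2
  refine Isometry.of_dist_eq fun μ ν => le_antisymm (key μ ν) ?_
  simpa only [neg_neg] using key (-μ) (-ν)

instance (d : ℕ) (δ : ℝ) : ContinuousNeg (SphereThickening d δ) :=
  ⟨(isometry_neg_thickening d δ).continuous⟩

/-! ### Odd maps and the coindex -/

/-- There is a continuous odd map `S^n → Y`, for a space `Y` with a continuous involution. -/
def ExistsOddMap (n : ℕ) (Y : Type*) [TopologicalSpace Y] [InvolutiveNeg Y] [ContinuousNeg Y] :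
    Prop :=
  ∃ f : Sphere n → Y, Continuous f ∧ ∀ x, f (-x) = -f x

/-- The coindex of `Y`: the largest `n` such that there is a continuous odd map `S^n → Y`
(`⊤` if there are such maps for arbitrarily large `n`). -/
def coindex (Y : Type*) [TopologicalSpace Y] [InvolutiveNeg Y] [ContinuousNeg Y] : ℕ∞ :=
  ⨆ n ∈ {n : ℕ | ExistsOddMap n Y}, (n : ℕ∞)

end

end VR

/-! ### Nearly orthogonal vectors -/

namespace VR

open Matrix
open scoped Kronecker

/-! The boundary of the cross-polytope with `d + k + 1` pairs of antipodal vertices is a copy of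
`S^(d+k)`, and its faces never contain both vertices of a pair. Send the pairs to `±v_i` for unit
vectors `v_i` in `ℝ^(d+1)` and extend affinely to measures. If all `|⟨v_i, v_j⟩| ≤ c` for `i ≠ j`,
the support of each image measure has diameter at most `π - arccos c`. The map is odd, and
continuous because the Wasserstein distance is at most `π` times the total variation
(`existsOddMap_of_dist_le`, `wasserstein_map_le`).

It remains to find `n + k` nearly orthogonal unit vectors in `ℝⁿ`, where `n = d + 1`, that is, a
Gram matrix close to the identity whose kernel has dimension at least `k`. Take `1 - M` with `M`
symmetric, `M³ = M`, small entries and eigenvalue `1` of multiplicity `(tr M + tr M²) / 2 ≥ k`. Such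
an `M` arises by repeating each entry of a trace-zero symmetric Hadamard matrix of order `m`, `2k ≤
m ≤ 4k`, in a `q × q` block, with `q` about `n / m`. Its entries are about `√m / n` at most, and `√m
< 2√(k+2)` strictly; for large `n` this slack absorbs all rounding errors. Thus `ε` is needed only
for finitely many `d`. -/

/-- Symmetric Hadamard matrices of Sylvester type, with vanishing trace. -/
theorem exists_symmetric_hadamard (j : ℕ) :
    ∃ (ι : Type) (_ : Fintype ι) (_ : DecidableEq ι) (W : Matrix ι ι ℝ),
      Fintype.card ι = 2 ^ (j + 1) ∧ Wᵀ = W ∧ W * W = (2 ^ (j + 1) : ℝ) • 1 ∧ W.trace = 0 ∧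
        ∀ a b, |W a b| ≤ 1 := by
  -- Sylvester doubling. The diagonal blocks `W` and `-W` cancel in the trace whatever the trace of
  -- `W` is, so the family starts at order 2, one doubling after the matrix `(1)`.
  have step : ∀ (ι : Type) [Fintype ι] [DecidableEq ι] (c : ℝ) (W : Matrix ι ι ℝ),
      Wᵀ = W → W * W = c • 1 → (∀ a b, |W a b| ≤ 1) →
      (fromBlocks W W W (-W))ᵀ = fromBlocks W W W (-W) ∧
      fromBlocks W W W (-W) * fromBlocks W W W (-W) = (2 * c) • 1 ∧
      (fromBlocks W W W (-W)).trace = 0 ∧ ∀ a b, |fromBlocks W W W (-W) a b| ≤ 1 := by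
    intro ι _ _ c W hT hW hb
    refine ⟨by simp [fromBlocks_transpose, hT], ?_, by simp [trace, Fintype.sum_sum_type], ?_⟩
    · rw [fromBlocks_multiply, ← fromBlocks_one, fromBlocks_smul]
      simp [hW, two_mul, add_smul]
    · rintro (a | a) (b | b) <;> simpa using hb a b
  induction j with
  | zero =>
    obtain ⟨h1, h2, h3, h4⟩ := step Unit 1 1 (by simp) (by simp) (by simp)
    exact ⟨Unit ⊕ Unit, inferInstance, inferInstance, _, by simp, h1, by simpa using h2, h3, h4⟩
  | succ j ih =>
    obtain ⟨ι, _, _, W, hc, hT, hW, -, hb⟩ := ih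
    obtain ⟨h1, h2, h3, h4⟩ := step ι _ W hT hW hb
    exact ⟨ι ⊕ ι, inferInstance, inferInstance, _, by simp [hc]; ring, h1,
      by rw [h2]; congr 1; ring, h3, h4⟩

/-- Blowing up a symmetric Hadamard matrix and padding it by zeros yields a symmetric matrix with
eigenvalues in `{-1, 0, 1}` and small entries. -/
theorem exists_symmetric_tripotent {j q r N : ℕ} (hq : 0 < q)
    (hN : 2 ^ (j + 1) * q + r = N) :
    ∃ M : Matrix (Fin N) (Fin N) ℝ,
      Mᵀ = M ∧ M * M * M = M ∧ M.trace = 0 ∧ (M * M).trace = 2 ^ (j + 1) ∧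
        ∀ a b, |M a b| ≤ 1 / (q * √(2 ^ (j + 1))) := by
  obtain ⟨ι, _, _, W, hc, hT, hW, htr, hb⟩ := exists_symmetric_hadamard j
  set m : ℝ := 2 ^ (j + 1) with hm
  have hm0 : 0 < m := by positivity
  have hq0 : (0 : ℝ) < q := by exact_mod_cast hq
  set β : ℝ := 1 / (q * √m) with hβ
  have hβ0 : 0 ≤ β := by positivity
  -- `β` is normalized so that `A = β (W ⊗ J)` squares to `1 ⊗ (J / q)`: here `W² = m` and `J² =
  -- qJ`. As `J / q` is a projection, `A³ = A` and `tr A² = m`.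
  have hββ : β * β * m * q = 1 / q := by
    have := Real.mul_self_sqrt hm0.le
    have hs : √m ≠ 0 := by positivity
    rw [hβ]
    field_simp
    nlinarith
  let J : Matrix (Fin q) (Fin q) ℝ := of fun _ _ => 1
  have hJ : J * J = (q : ℝ) • J := by
    ext a b; simp [J, mul_apply]
  have hJT : Jᵀ = J := rfl
  let A := β • (W ⊗ₖ J)
  have hAT : Aᵀ = A := by
    simp only [A, transpose_smul, ← kroneckerMap_transpose, hT, hJT]
  have hA2 : A * A = (1 / q : ℝ) • ((1 : Matrix ι ι ℝ) ⊗ₖ J) := by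
    simp only [A, smul_mul_assoc, mul_smul_comm, ← mul_kronecker_mul, hW, hJ, smul_kronecker,
      kronecker_smul, smul_smul]
    rw [← hββ]
    ring_nf
  have hA3 : A * A * A = A := by
    rw [hA2]
    simp only [A, smul_mul_assoc, mul_smul_comm, ← mul_kronecker_mul, hJ,
      kronecker_smul, smul_smul, one_mul]
    congr 1
    field_simp
  let M₀ : Matrix ((ι × Fin q) ⊕ Fin r) ((ι × Fin q) ⊕ Fin r) ℝ := fromBlocks A 0 0 0
  have e : (ι × Fin q) ⊕ Fin r ≃ Fin N :=
    Fintype.equivFinOfCardEq (by simp [hc, hN])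
  have h2 : M₀ * M₀ = fromBlocks (A * A) 0 0 0 := by simp [M₀, fromBlocks_multiply]
  have htrace : ∀ B : Matrix ((ι × Fin q) ⊕ Fin r) ((ι × Fin q) ⊕ Fin r) ℝ,
      (B.submatrix e.symm e.symm).trace = B.trace := fun B => by
    simp only [trace, diag, submatrix_apply]
    exact e.symm.sum_comp fun i => B i i
  have htb : ∀ B : Matrix (ι × Fin q) (ι × Fin q) ℝ,
      (fromBlocks B 0 0 (0 : Matrix (Fin r) (Fin r) ℝ)).trace = B.trace := fun B => by
    simp [trace, Fintype.sum_sum_type]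
  refine ⟨M₀.submatrix e.symm e.symm, ?_, ?_, ?_, ?_, ?_⟩
  · rw [transpose_submatrix]
    simp [M₀, fromBlocks_transpose, hAT]
  · rw [submatrix_mul_equiv, submatrix_mul_equiv, h2]
    simp [M₀, fromBlocks_multiply, hA3]
  · rw [htrace]
    simp [M₀, A, htb, trace_kronecker, htr]
  · rw [submatrix_mul_equiv, htrace, h2, htb, hA2, trace_smul, trace_kronecker]
    simp [J, trace, hc, hm]
    field_simp
  · intro a b
    simp only [submatrix_apply]
    rcases e.symm a with a | a <;> rcases e.symm b with b | b
    · simpa [M₀, A, J, abs_mul, abs_of_nonneg hβ0] using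
        mul_le_mul_of_nonneg_left (hb a.1 b.1) hβ0
    all_goals simpa [M₀] using hβ0

/-! ### Gram matrices of low rank -/

/-- An idempotent is the projection onto its range. This turns the trace condition on `M` into a
lower bound for an eigenvalue multiplicity. -/
theorem rank_of_isIdempotentElem {ι : Type*} [Fintype ι] [DecidableEq ι] {E : Matrix ι ι ℝ}
    (hE : E * E = E) : (E.rank : ℝ) = E.trace := by
  have hp : IsIdempotentElem (toLin' E) := by
    change toLin' E * toLin' E = toLin' E
    rw [Module.End.mul_eq_comp, ← toLin'_mul, hE]
  have h := (LinearMap.IsIdempotentElem.isProj_range _ hp).trace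
  rw [trace_toLin'_eq] at h
  exact h.symm

/-- The Gram matrix of the columns of a matrix of rank at most `n` is realized in `ℝⁿ`. -/
theorem exists_gram_of_rank_le {ι : Type*} [Fintype ι] [DecidableEq ι] {B : Matrix ι ι ℝ} {n : ℕ}
    (hB : B.rank ≤ n) :
    ∃ v : ι → EuclideanSpace ℝ (Fin n), ∀ i j, inner ℝ (v i) (v j) = (Bᵀ * B) i j := by
  let S := LinearMap.range (toLpLin 2 2 B)
  have hS : Module.finrank ℝ S ≤ n := by
    rw [rank_eq_finrank_range_toLin B (PiLp.basisFun 2 ℝ ι) (PiLp.basisFun 2 ℝ ι)] at hB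
    exact hB
  let b := stdOrthonormalBasis ℝ S
  -- The column space of `B` has dimension at most `n`; matching an orthonormal basis of it with the
  -- first coordinate vectors embeds it isometrically in `ℝⁿ`.
  let f : S →ₗ[ℝ] EuclideanSpace ℝ (Fin n) :=
    b.toBasis.constr ℝ fun i => EuclideanSpace.basisFun (Fin n) ℝ (Fin.castLE hS i)
  have hf : Orthonormal ℝ (f ∘ b.toBasis) := by
    have : f ∘ b.toBasis = EuclideanSpace.basisFun (Fin n) ℝ ∘ Fin.castLE hS := by
      funext i; simp only [f, Function.comp, Module.Basis.constr_basis]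
    rw [this]
    exact (EuclideanSpace.basisFun (Fin n) ℝ).orthonormal.comp _ (Fin.castLE_injective hS)
  let g := f.isometryOfOrthonormal (v := b.toBasis) (by simp) hf
  refine ⟨fun i => g ⟨_, LinearMap.mem_range_self (toLpLin 2 2 B) (EuclideanSpace.single i 1)⟩,
    fun i j => ?_⟩
  rw [g.inner_map_map]
  simp [Submodule.coe_inner, PiLp.inner_apply, mul_apply, toLpLin_apply, mul_comm]

/-- A symmetric matrix `M` with eigenvalues in `{-1, 0, 1}`, of which `k` or more equal `1`, gives
vectors in codimension `k` with Gram matrix `1 - M`. -/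
theorem exists_gram_one_sub {N n k : ℕ} {M : Matrix (Fin N) (Fin N) ℝ} (hT : Mᵀ = M)
    (h3 : M * M * M = M) (htr : (2 * k : ℝ) ≤ M.trace + (M * M).trace) (hN : N ≤ n + k) :
    ∃ v : Fin N → EuclideanSpace ℝ (Fin n), ∀ i j,
      inner ℝ (v i) (v j) = (1 - M : Matrix (Fin N) (Fin N) ℝ) i j := by
  have h3' : M * (M * M) = M := by rw [← mul_assoc, h3]
  have h4 : M * M * (M * M) = M * M := by rw [← mul_assoc, h3]
  -- `(x + x²) / 2` takes the values `0, 0, 1` at `-1, 0, 1`, so `E` is the projection onto the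
  -- eigenspace of `1`.
  let E := (1 / 2 : ℝ) • (M + M * M)
  have hE : E * E = E := by
    simp only [E, smul_mul_assoc, mul_smul_comm, mul_add, add_mul, h3, h3', h4]
    module
  have hs : √(1 / 2) * √(1 / 2) = (1 / 2 : ℝ) := Real.mul_self_sqrt (by norm_num)
  -- The square root of `1 - M`, interpolated on the spectrum: the values at `-1, 0, 1` are `√2, 1,
  -- 0`. It kills the range of `E`, whence `rank B ≤ N - k ≤ n`.
  let B := (1 - M * M) + √(1 / 2) • (M * M - M)
  have hBT : Bᵀ = B := by simp [B, hT]
  have hBB : B * B = 1 - M := by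
    simp only [B, smul_mul_assoc, mul_smul_comm, mul_add, add_mul, mul_sub, sub_mul, h3, h3', h4,
      one_mul, mul_one]
    linear_combination (norm := module) hs • ((2 : ℝ) • (M * M - M))
  have hBE : B * E = 0 := by
    simp only [B, E, smul_mul_assoc, mul_smul_comm, mul_add, add_mul, sub_mul, h3, h3', h4,
      one_mul]
    module
  have hrank := rank_add_rank_le_card_of_mul_eq_zero hBE
  have hkE : k ≤ E.rank := by
    have : (k : ℝ) ≤ E.rank := by
      rw [rank_of_isIdempotentElem hE, trace_smul, trace_add, smul_eq_mul]
      linarith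
    exact_mod_cast this
  rw [Fintype.card_fin] at hrank
  obtain ⟨v, hv⟩ := exists_gram_of_rank_le (B := B) (n := n) (by omega)
  exact ⟨v, fun i j => by rw [hv, hBT, hBB]⟩

/-- Rescaling the vectors of `exists_gram_one_sub` to unit length. -/
theorem exists_unit_vectors {N n k : ℕ} {M : Matrix (Fin N) (Fin N) ℝ} (hT : Mᵀ = M)
    (h3 : M * M * M = M) (htr : (2 * k : ℝ) ≤ M.trace + (M * M).trace) (hN : N ≤ n + k)
    {β : ℝ} (hβ : β < 1) (hM : ∀ i j, |M i j| ≤ β) :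
    ∃ v : Fin N → EuclideanSpace ℝ (Fin n), (∀ i, ‖v i‖ = 1) ∧
      ∀ i j, i ≠ j → |inner ℝ (v i) (v j)| ≤ β / (1 - β) := by
  obtain ⟨w, hw⟩ := exists_gram_one_sub hT h3 htr hN
  have hnorm : ∀ i, 1 - β ≤ ‖w i‖ ^ 2 := fun i => by
    rw [← real_inner_self_eq_norm_sq, hw, Matrix.sub_apply, one_apply_eq]
    linarith [(abs_le.mp (hM i i)).2]
  have hpos : ∀ i, 0 < ‖w i‖ := fun i =>
    (norm_nonneg _).lt_of_ne fun h => by have := hnorm i; rw [← h] at this; linarith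
  refine ⟨fun i => ‖w i‖⁻¹ • w i, fun i => ?_, fun i j hij => ?_⟩
  · rw [norm_smul, norm_inv, norm_norm, inv_mul_cancel₀ (hpos i).ne']
  · rw [real_inner_smul_left, real_inner_smul_right, hw, Matrix.sub_apply, one_apply_ne hij, zero_sub,
      abs_mul, abs_mul, abs_neg, abs_of_pos (inv_pos.mpr (hpos i)),
      abs_of_pos (inv_pos.mpr (hpos j)), ← mul_assoc, ← mul_inv, mul_comm, ← div_eq_mul_inv]
    have h1 : 1 - β ≤ ‖w i‖ * ‖w j‖ := by
      refine abs_le_of_sq_le_sq' ?_ (by have := hpos i; have := hpos j; positivity) |>.2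
      rw [mul_pow, sq (1 - β)]
      exact mul_le_mul (hnorm i) (hnorm j) (by linarith) (by positivity)
    exact div_le_div₀ ((abs_nonneg _).trans (hM i j)) (hM i j) (by linarith) h1

/-! ### Choice of the parameters -/

/-- For large `n` there are `n + k` unit vectors in `ℝⁿ` of coherence at most `2 √(k + 2) / n`. -/
theorem exists_nearly_orthogonal (k : ℕ) (hk : 1 ≤ k) :
    ∃ n₀ : ℕ, ∀ n ≥ n₀, ∃ v : Fin (n + k) → EuclideanSpace ℝ (Fin n), (∀ i, ‖v i‖ = 1) ∧
      ∀ i j, i ≠ j → |inner ℝ (v i) (v j)| ≤ 2 * √(k + 2) / n := by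
  -- The least power of two that is at least `k`. Then `m = 2 ^ (j + 1)` satisfies `m / 2 ≥ k`, the
  -- multiplicity required, and `√m ≤ 2√k < t`.
  obtain ⟨j, hj1, hj2⟩ : ∃ j, k ≤ 2 ^ j ∧ 2 ^ j ≤ 2 * k := by
    refine ⟨Nat.clog 2 k, Nat.le_pow_clog one_lt_two k, ?_⟩
    rcases hk.eq_or_lt with rfl | h
    · simp
    · have h1 := Nat.pow_pred_clog_lt_self one_lt_two h
      have h2 : 0 < Nat.clog 2 k := Nat.clog_pos one_lt_two h
      obtain ⟨c, hc⟩ := Nat.exists_eq_succ_of_ne_zero h2.ne'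
      rw [hc] at h1 ⊢
      simp only [Nat.pred_succ, Nat.succ_eq_add_one, pow_succ] at h1 ⊢
      omega
  set m : ℕ := 2 ^ (j + 1) with hm
  have hm4 : m ≤ 4 * k := by rw [hm, pow_succ]; omega
  have hm0 : 0 < m := by positivity
  have hmR : (m : ℝ) = 2 ^ (j + 1) := by simp [hm]
  set s : ℝ := √m with hs
  set t : ℝ := 2 * √(k + 2) with ht
  have hs0 : 0 < s := by positivity
  have hss : s * s = m := Real.mul_self_sqrt (by positivity)
  have ht2 : t * t = 4 * (k + 2) := by
    have := Real.mul_self_sqrt (show (0 : ℝ) ≤ k + 2 by positivity)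
    rw [ht]; linarith
  have ht0 : 0 < t := by positivity
  have hst : s < t := by
    have : (m : ℝ) ≤ 4 * k := by exact_mod_cast hm4
    nlinarith
  have hgap : 0 < 1 / s - 1 / t := sub_pos.mpr (one_div_lt_one_div_of_lt hs0 hst)
  -- The gain `n (1/s - 1/t)` grows linearly and must beat a constant: `m / s` is lost by rounding
  -- `q` down, `1` by rescaling to unit length.
  obtain ⟨n₀, hn₀⟩ := exists_nat_ge ((1 + m / s) / (1 / s - 1 / t))
  refine ⟨max (m + 1) n₀, fun n hn => ?_⟩
  have hn1 : m + 1 ≤ n := (le_max_left _ _).trans hn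
  have hnR : (0 : ℝ) < n := by exact_mod_cast (by omega : 0 < n)
  have hn2 : 1 + m / s ≤ n * (1 / s - 1 / t) := by
    rw [← div_le_iff₀ hgap]
    exact hn₀.trans (by exact_mod_cast (le_max_right _ _).trans hn)
  have hdiv : m * ((n + k) / m) + (n + k) % m = n + k := Nat.div_add_mod _ _
  have hq : 0 < (n + k) / m := Nat.div_pos (by omega) hm0
  obtain ⟨M, hT, h3, htr, htr2, hb⟩ := exists_symmetric_tripotent hq (hm ▸ hdiv)
  rw [← hmR, ← hs] at hb
  rw [← hmR] at htr2
  set q : ℕ := (n + k) / m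
  -- the reciprocal of the entry bound is large
  have hqs : n / t + 1 ≤ q * s := by
    have hmod : (n + k) % m < m := Nat.mod_lt _ hm0
    have h1 : (n : ℝ) ≤ m * q + m := by
      have : n ≤ m * q + m := by omega
      exact_mod_cast this
    have h2 : n / s ≤ q * s + m / s := by
      rw [div_le_iff₀ hs0, add_mul, div_mul_cancel₀ _ hs0.ne', mul_assoc, hss]
      linarith
    have h3 : (n : ℝ) * (1 / s - 1 / t) = n / s - n / t := by ring
    linarith
  have hnt : 0 < n / t := by positivity
  have hβ1 : 1 / (q * s) < 1 := by rw [div_lt_one] <;> linarith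
  obtain ⟨v, hv1, hv2⟩ := exists_unit_vectors (k := k) (n := n) hT h3 (by
    rw [htr, htr2, zero_add, hm]; exact_mod_cast (by rw [pow_succ]; omega)) le_rfl hβ1 hb
  refine ⟨v, hv1, fun i j hij => (hv2 i j hij).trans ?_⟩
  have hqs0 : 0 < q * s := by linarith
  have heq : 1 / (q * s) / (1 - 1 / (q * s)) = 1 / (q * s - 1) := by
    have : q * s - 1 ≠ 0 := by linarith
    field_simp
  rw [heq, ← one_div_div (n : ℝ) t]
  exact one_div_le_one_div_of_le hnt (by linarith)

end VR

/-! ### Odd maps into Vietoris-Rips thickenings from the boundary of the cross-polytope -/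

namespace VR

open Convexity

theorem integral_fintype {I : Type*} [Fintype I] (μ : StdSimplex ℝ I) (F : I → ℝ) :
    integral μ F = ∑ i, μ.weights i * F i :=
  Finsupp.sum_fintype _ _ (by simp)

/-- The probability measure on a finite type with given weights. -/
noncomputable def ofWeights {I : Type*} [Fintype I] (w : I → ℝ) (h0 : ∀ i, 0 ≤ w i)
    (h1 : ∑ i, w i = 1) : StdSimplex ℝ I where
  weights := Finsupp.equivFunOnFinite.symm w
  nonneg := h0
  total := by rw [Finsupp.sum_fintype _ _ (by simp)]; exact h1

theorem integral_ofWeights {I : Type*} [Fintype I] {w : I → ℝ} (h0 : ∀ i, 0 ≤ w i)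
    (h1 : ∑ i, w i = 1) (F : I → ℝ) : integral (ofWeights w h0 h1) F = ∑ i, w i * F i :=
  integral_fintype _ _

theorem sum_weights {I : Type*} [Fintype I] (μ : StdSimplex ℝ I) : ∑ i, μ.weights i = 1 := by
  rw [← μ.total, Finsupp.sum_fintype _ _ (by simp)]

/-- The coupling that leaves the common mass of two measures in place moves at most the total
variation of their difference. -/
theorem wasserstein_map_le {I X : Type*} [Fintype I] [MetricSpace X] (p : I → X) {C : ℝ}
    (hC : ∀ i j, dist (p i) (p j) ≤ C) (σ τ : StdSimplex ℝ I) :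
    wasserstein (σ.map p) (τ.map p) ≤ C * ∑ i, |σ.weights i - τ.weights i| := by
  classical
  let a : I → ℝ := fun i => σ.weights i
  let b : I → ℝ := fun i => τ.weights i
  let u : I → ℝ := fun i => max (a i - b i) 0
  let w : I → ℝ := fun i => max (b i - a i) 0
  have hu : ∀ i, 0 ≤ u i := fun i => le_max_right _ _
  have hw : ∀ i, 0 ≤ w i := fun i => le_max_right _ _
  have hua : ∀ i, min (a i) (b i) + u i = a i := fun i => by
    rcases le_total (a i) (b i) with h | h <;> simp [u, h]
  have hwb : ∀ i, min (a i) (b i) + w i = b i := fun i => by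
    rcases le_total (a i) (b i) with h | h <;> simp [w, h]
  obtain ⟨i₀⟩ := σ.nonempty
  have hC0 : 0 ≤ C := dist_nonneg.trans (hC i₀ i₀)
  set c : ℝ := ∑ i, w i with hc
  have hcu : ∑ i, u i = c := by
    have h1 : ∑ i, (min (a i) (b i) + u i) = 1 := by simp only [hua]; exact sum_weights σ
    have h2 : ∑ i, (min (a i) (b i) + w i) = 1 := by simp only [hwb]; exact sum_weights τ
    rw [Finset.sum_add_distrib] at h1 h2
    linarith
  -- If `c = 0`, all `u i` vanish, and division by zero gives the correct value.
  have huc : ∀ i, u i * c / c = u i := fun i => by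
    by_cases h : c = 0
    · rw [h] at hcu ⊢
      rw [(Finset.sum_eq_zero_iff_of_nonneg fun i _ => hu i).mp hcu i (Finset.mem_univ i)]
      simp
    · exact mul_div_cancel_right₀ _ h
  have hwc : ∀ i, w i * c / c = w i := fun i => by
    by_cases h : c = 0
    · rw [(Finset.sum_eq_zero_iff_of_nonneg fun i _ => hw i).mp (hc ▸ h) i (Finset.mem_univ i)]
      simp
    · exact mul_div_cancel_right₀ _ h
  -- The common mass stays on the diagonal; the surplus `u` is spread over the deficit `w` by the
  -- product coupling. Only the second term costs anything, at most `C * ∑ u`.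
  let g : I × I → ℝ := fun q =>
    (if q.1 = q.2 then min (a q.1) (b q.1) else 0) + u q.1 * w q.2 / c
  have hg0 : ∀ q, 0 ≤ g q := fun q => by
    have h1 : 0 ≤ min (a q.1) (b q.1) := le_min (σ.weights_nonneg _) (τ.weights_nonneg _)
    have h2 : 0 ≤ u q.1 * w q.2 / c :=
      div_nonneg (mul_nonneg (hu _) (hw _)) (Finset.sum_nonneg fun i _ => hw i)
    simp only [g]
    split_ifs <;> linarith
  have hrow : ∀ i, ∑ j, g (i, j) = a i := fun i => by
    simp only [g, Finset.sum_add_distrib, Finset.sum_ite_eq, Finset.mem_univ, if_true,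
      ← Finset.mul_sum, ← Finset.sum_div, ← hc, huc, hua]
  have hcol : ∀ j, ∑ i, g (i, j) = b j := fun j => by
    simp only [g, Finset.sum_add_distrib, Finset.sum_ite_eq', Finset.mem_univ, if_true,
      ← Finset.sum_mul, ← Finset.sum_div, hcu, mul_comm c, hwc, hwb]
  have hg1 : ∑ q, g q = 1 := by
    rw [Fintype.sum_prod_type]
    simp only [hrow]
    exact sum_weights σ
  let γ := ofWeights g hg0 hg1
  have hγ : IsCoupling γ σ τ := by
    constructor <;> refine ext_integral fun F => ?_ <;>
      rw [integral_map, integral_ofWeights, integral_fintype]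
    · simp only [Fintype.sum_prod_type, Function.comp, ← Finset.sum_mul, hrow, a]
    · simp only [Fintype.sum_prod_type_right, Function.comp, ← Finset.sum_mul, hcol, b]
  refine (wasserstein_le (hγ.map p)).trans ?_
  rw [integral_map, integral_ofWeights]
  have h1 : ∀ q : I × I, g q * dist (p q.1) (p q.2) ≤ u q.1 * w q.2 / c * C := fun q => by
    have h2 : 0 ≤ u q.1 * w q.2 / c :=
      div_nonneg (mul_nonneg (hu _) (hw _)) (Finset.sum_nonneg fun i _ => hw i)
    by_cases h : q.1 = q.2
    · rw [h, dist_self, mul_zero, ← h]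
      positivity
    · simp only [g, if_neg h, zero_add]
      exact mul_le_mul_of_nonneg_left (hC _ _) h2
  refine (Finset.sum_le_sum fun q _ => h1 q).trans ?_
  rw [← Finset.sum_mul, Fintype.sum_prod_type, mul_comm]
  refine mul_le_mul_of_nonneg_left (Finset.sum_le_sum fun i _ => ?_) hC0
  simp only [← Finset.sum_div, ← Finset.mul_sum, ← hc, huc]
  exact max_le (le_abs_self _) (abs_nonneg _)

/-! ### The sphere as the boundary of the cross-polytope -/

/-- The weights on the vertices of the cross-polytope, indexed by `Fin (n + 1) × Bool`, of the
radial projection of a point of the sphere to its boundary. -/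
noncomputable def crossWeight {n : ℕ} (x : Sphere n) (p : Fin (n + 1) × Bool) : ℝ :=
  max (if p.2 then x.1 p.1 else -x.1 p.1) 0 / ∑ i, |x.1 i|

theorem sum_abs_pos {n : ℕ} (x : Sphere n) : 0 < ∑ i, |x.1 i| := by
  refine (Finset.sum_nonneg fun i _ => abs_nonneg _).lt_of_ne' fun h => ?_
  refine ne_zero_of_mem_unit_sphere x (PiLp.ext fun i => ?_)
  exact abs_eq_zero.mp
    ((Finset.sum_eq_zero_iff_of_nonneg fun i _ => abs_nonneg _).mp h i (Finset.mem_univ i))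

theorem crossWeight_nonneg {n : ℕ} (x : Sphere n) (p) : 0 ≤ crossWeight x p :=
  div_nonneg (le_max_right _ _) (sum_abs_pos x).le

theorem sum_crossWeight {n : ℕ} (x : Sphere n) : ∑ p, crossWeight x p = 1 := by
  have h : ∀ t : ℝ, max t 0 + max (-t) 0 = |t| := fun t => by
    rcases le_total 0 t with h | h <;> simp [h, abs_of_nonneg, abs_of_nonpos]
  simp only [crossWeight, ← Finset.sum_div, Fintype.sum_prod_type, Fintype.sum_bool, if_true,
    Bool.false_eq_true, if_false, h]
  exact div_self (sum_abs_pos x).ne'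

theorem crossWeight_neg {n : ℕ} (x : Sphere n) (i : Fin (n + 1)) (s : Bool) :
    crossWeight (-x) (i, s) = crossWeight x (i, !s) := by
  cases s <;> simp [crossWeight]

/-- A coordinate and its negative are not both positive. Hence no antipodal pair of vertices carries
mass at once. -/
theorem crossWeight_eq_zero_or {n : ℕ} (x : Sphere n) (i : Fin (n + 1)) (s : Bool) :
    crossWeight x (i, s) = 0 ∨ crossWeight x (i, !s) = 0 := by
  rcases le_total 0 (x.1 i) with h | h <;> cases s <;> simp [crossWeight, h]

theorem continuous_crossWeight {n : ℕ} (p : Fin (n + 1) × Bool) :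
    Continuous fun x : Sphere n => crossWeight x p := by
  have hx : ∀ i, Continuous fun x : Sphere n => x.1 i := fun i => by fun_prop
  refine Continuous.div ?_ (by fun_prop) fun x => (sum_abs_pos x).ne'
  split_ifs <;> fun_prop

/-- Points `±v₀, …, ±vₙ` of `S^d` such that vertices of different index are at distance at most `δ`
span an odd map `S^n → S^d_δ`. -/
theorem existsOddMap_of_dist_le {n d : ℕ} {δ : ℝ} (hδ : 0 ≤ δ) (v : Fin (n + 1) → GeoSphere d)
    (h1 : ∀ i j, i ≠ j → dist (v i) (v j) ≤ δ) (h2 : ∀ i j, i ≠ j → dist (v i) (-v j) ≤ δ) :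
    ExistsOddMap n (SphereThickening d δ) := by
  classical
  let pt : Fin (n + 1) × Bool → GeoSphere d := fun p => if p.2 then v p.1 else -v p.1
  let σ : Sphere n → StdSimplex ℝ (Fin (n + 1) × Bool) := fun x =>
    ofWeights (crossWeight x) (crossWeight_nonneg x) (sum_crossWeight x)
  have hpt : ∀ p q : Fin (n + 1) × Bool, p.1 ≠ q.1 → dist (pt p) (pt q) ≤ δ := by
    rintro ⟨i, _ | _⟩ ⟨j, _ | _⟩ h
    · exact ((isometry_neg d).dist_eq (v i) (v j)).trans_le (h1 i j h)
    · exact (dist_comm _ _).trans_le (h2 j i (Ne.symm h))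
    · exact h2 i j h
    · exact h1 i j h
  have hσ : ∀ x, ∀ y ∈ ((σ x).map pt).weights.support, ∃ p, crossWeight x p ≠ 0 ∧ pt p = y := by
    intro x y hy
    obtain ⟨p, hp, rfl⟩ := Finset.mem_image.mp (Finsupp.mapDomain_support hy)
    exact ⟨p, Finsupp.mem_support_iff.mp hp, rfl⟩
  let f : Sphere n → SphereThickening d δ := fun x => ⟨(σ x).map pt, by
    intro y hy z hz
    obtain ⟨⟨i, s⟩, hp, rfl⟩ := hσ x y hy
    obtain ⟨⟨j, t⟩, hq, rfl⟩ := hσ x z hz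
    -- Two vertices of equal index that both carry mass coincide, so `±v_i` never lie in one
    -- support.
    by_cases hij : i = j
    · subst hij
      have hst : s = t := by
        by_contra hst
        have : t = !s := by cases s <;> cases t <;> simp_all
        subst this
        exact (crossWeight_eq_zero_or x i s).elim hp hq
      rw [hst, dist_self]
      exact hδ
    · exact hpt _ _ hij⟩
  refine ⟨f, ?_, fun x => Subtype.ext (ext_integral fun F => ?_)⟩
  · refine continuous_iff_continuousAt.mpr fun x => tendsto_iff_dist_tendsto_zero.mpr ?_
    have hle : ∀ y, dist (f y) (f x) ≤ Real.pi * ∑ p, |crossWeight y p - crossWeight x p| :=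
      fun y => wasserstein_map_le pt (fun i j => InnerProductGeometry.angle_le_pi _ _) (σ y) (σ x)
    refine squeeze_zero (fun _ => dist_nonneg) hle ?_
    have hcont : Continuous fun y : Sphere n =>
        Real.pi * ∑ p, |crossWeight y p - crossWeight x p| := by
      have := fun p => continuous_crossWeight (n := n) p
      fun_prop
    simpa using hcont.tendsto x
  · change integral ((σ (-x)).map pt) F = integral (((σ x).map pt).map fun y => -y) F
    simp only [integral_map, σ, integral_ofWeights, Fintype.sum_prod_type, Fintype.sum_bool,
      crossWeight_neg]
    refine Finset.sum_congr rfl fun i _ => ?_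
    simp [pt, add_comm]

/-- Unit vectors of small coherence give an odd map. -/
theorem existsOddMap_of_inner_le {n d : ℕ} {δ c : ℝ} (hδ : Real.pi - Real.arccos c ≤ δ)
    (v : Fin (n + 1) → EuclideanSpace ℝ (Fin (d + 1))) (hv : ∀ i, ‖v i‖ = 1)
    (h : ∀ i j, i ≠ j → |inner ℝ (v i) (v j)| ≤ c) :
    ExistsOddMap n (SphereThickening d δ) := by
  have hδ0 : 0 ≤ δ := by linarith [Real.arccos_le_pi c]
  -- Since `π - arccos c = arccos (-c)`, only lower bounds on inner products matter; applying this
  -- to `v_j` and `-v_j` uses both sides of the bound on `|⟨v_i, v_j⟩|`. The clamping of `arccos`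
  -- makes it valid for every real `c`.
  have key : ∀ a b : EuclideanSpace ℝ (Fin (d + 1)), ‖a‖ = 1 → ‖b‖ = 1 → -c ≤ inner ℝ a b →
      InnerProductGeometry.angle a b ≤ δ := fun a b ha hb hab => by
    rw [InnerProductGeometry.angle, ha, hb, mul_one, div_one]
    refine (Real.arccos_le_arccos hab).trans ?_
    rwa [Real.arccos_neg]
  refine existsOddMap_of_dist_le hδ0
    (fun i => (⟨v i, by simp [hv i]⟩ : Sphere d)) (fun i j hij => ?_) (fun i j hij => ?_)
  · exact key _ _ (hv i) (hv j) (abs_le.mp (h i j hij)).1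
  · refine key _ _ (hv i) ((norm_neg _).trans (hv j)) ?_
    change -c ≤ inner ℝ (v i) (-v j)
    rw [inner_neg_right]
    exact neg_le_neg (abs_le.mp (h i j hij)).2

/-- The codes of `exists_nearly_orthogonal` as odd maps. -/
theorem exists_forall_existsOddMap (k : ℕ) (hk : 1 ≤ k) :
    ∃ d₁ : ℕ, ∀ d ≥ d₁, ∀ δ : ℝ, Real.pi - Real.arccos (2 * √(k + 2) / (d + 1)) ≤ δ →
      ExistsOddMap (d + k) (SphereThickening d δ) := by
  obtain ⟨n₀, h⟩ := exists_nearly_orthogonal k hk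
  refine ⟨n₀, fun d hd δ hδ => ?_⟩
  obtain ⟨v, hv, hvv⟩ := h (d + 1) (by omega)
  have e : d + k + 1 = d + 1 + k := by omega
  refine existsOddMap_of_inner_le hδ (fun i => v (Fin.cast e i)) (fun i => hv _) fun i j hij => ?_
  simpa using hvv _ _ ((Fin.cast_injective e).ne hij)

/-- At scale `π` the diameter is no constraint, so all `v_i` may be the same vector, of coherence
`1`. -/
theorem existsOddMap_of_pi_le {n d : ℕ} {δ : ℝ} (hδ : Real.pi ≤ δ) :
    ExistsOddMap n (SphereThickening d δ) :=
  existsOddMap_of_inner_le (c := 1) (by simpa using hδ) (fun _ => EuclideanSpace.single 0 1)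
    (by simp) (by simp)

end VR

/-! ### Passage to the limit and choice of `ε` -/

theorem mainTheorem11 (k : ℕ) (hk : 1 ≤ k) :
    (∀ δ : ℝ, Real.pi / 2 < δ → ∃ d₀ : ℕ, ∀ d : ℕ, d₀ ≤ d →
      VR.ExistsOddMap (d + k) (VR.SphereThickening d δ) ∧
      ((d + k : ℕ) : ℕ∞) ≤ VR.coindex (VR.SphereThickening d δ)) ∧
    ∃ ε : ℕ → ℝ, Filter.Tendsto ε Filter.atTop (nhds 0) ∧
      ∀ d : ℕ, 1 ≤ d → ∀ δ : ℝ, Real.pi / 2 < δ →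
        Real.pi - Real.arccos ((1 + ε d) * (2 * Real.sqrt (k + 2) / (d + 1))) < δ →
          VR.ExistsOddMap (d + k) (VR.SphereThickening d δ) := by
  obtain ⟨d₁, h⟩ := VR.exists_forall_existsOddMap k hk
  constructor
  · intro δ hδ
    have hlim : Filter.Tendsto (fun d : ℕ => Real.pi - Real.arccos (2 * √(k + 2) / ((d : ℝ) + 1)))
        Filter.atTop (nhds (Real.pi / 2)) := by
      have h0 : Filter.Tendsto (fun d : ℕ => 2 * √(k + 2) / ((d : ℝ) + 1)) Filter.atTop (nhds 0) :=
        tendsto_const_nhds.div_atTop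
          (Filter.tendsto_atTop_add_const_right _ _ tendsto_natCast_atTop_atTop)
      have h1 := (Real.continuous_arccos.tendsto 0).comp h0
      rw [Real.arccos_zero] at h1
      have h2 := h1.const_sub Real.pi
      rwa [sub_half] at h2
    obtain ⟨d₂, h₂⟩ := Filter.eventually_atTop.mp (hlim.eventually (gt_mem_nhds hδ))
    refine ⟨max d₁ d₂, fun d hd => ?_⟩
    have hodd := h d ((le_max_left _ _).trans hd) δ (h₂ d ((le_max_right _ _).trans hd)).le
    exact ⟨hodd, le_iSup₂_of_le (d + k) hodd le_rfl⟩
  -- For `d < d₁` the factor `1 + ε d = d + 1` cancels the denominator, leaving `2√(k+2) ≥ 1`; then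
  -- the `arccos` is `0` and the hypothesis reads `δ > π`.
  · refine ⟨fun d => if d < d₁ then d else 0, ?_, fun d _ δ _ hlt => ?_⟩
    · refine tendsto_const_nhds.congr' ?_
      filter_upwards [Filter.eventually_ge_atTop d₁] with d hd
      simp [hd]
    · beta_reduce at hlt
      by_cases hd : d < d₁
      · refine VR.existsOddMap_of_pi_le ?_
        have hs : 1 ≤ √((k : ℝ) + 2) := Real.one_le_sqrt.mpr (by linarith [k.cast_nonneg (α := ℝ)])
        have ht : (1 : ℝ) ≤ (1 + d) * (2 * √(k + 2) / (d + 1)) := by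
          have : ((1 : ℝ) + d) * (2 * √(k + 2) / (d + 1)) = 2 * √(k + 2) := by
            field_simp
            ring
          linarith
        rw [if_pos hd, Real.arccos_eq_zero.mpr ht, sub_zero] at hlt
        exact hlt.le
      · rw [if_neg hd, add_zero, one_mul] at hlt
        exact h d (not_lt.mp hd) δ hlt.le
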